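/- An oriented graph is a directed graph without loops, multiple arcs or 2-cycles. For oriented graphs $H$ and $G$, let $N(H,G)$ be the number of vertex sets of $G$ that induce an oriented graph isomorphic to $H$. The inducibility of an oriented graph $H$ on $k$ vertices is $$I(H)=\lim_{n\to\infty}\frac{\max\{N(H,G): G \text{ an oriented graph with } |V(G)|=n\}}{\binom{n}{k}}.$$ Let $H=\overrightarrow{C_3}\sqcup K_1$ be the oriented graph on four vertices that is the disjoint union of a directed triangle and an isolated vertex. Then the limit defining $I(H)$ exists and $I(H)=\frac18$. Moreover, this value is attained asymptotically by balanced disjoint unions of two arbitrary regular tournaments (tournaments in which every vertex has equal outdegree and indegree): if $R_j$ and $S_j$ are regular tournaments on $a_j$ and $b_j$ vertices respectively, with $a_j+b_j\to\infty$ and $\frac{a_j}{a_j+b_j}\to\frac12$ as $j\to\infty$, then $$\lim_{j\to\infty}\frac{N(H,R_j\sqcup S_j)}{\binom{a_j+b_j}{4}}=\frac18 .$$ -/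

import Mathlib

open Filter Topology

/-- An oriented graph on `V`: a directed graph without loops, multiple arcs or 2-cycles
(asymmetry of the arc relation also excludes loops). -/
structure OrientedGraph (V : Type*) extends Digraph V where
  asymm : ∀ u v : V, Adj u v → ¬ Adj v u

namespace OrientedGraph

/-- The oriented graph induced by `G` on the vertex set `S`. -/
def induce {V : Type*} (G : OrientedGraph V) (S : Finset V) : OrientedGraph S where
  Adj u v := G.Adj u v
  asymm u v h := G.asymm u v h

/-- Isomorphism of oriented graphs: a bijection of the vertices that preserves and reflects arcs. -/
def IsIso {V W : Type*} (G : OrientedGraph V) (H : OrientedGraph W) : Prop :=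
  Nonempty (G.Adj ≃r H.Adj)

/-- The oriented graph without arcs. -/
def empty (V : Type*) : OrientedGraph V where
  Adj _ _ := False
  asymm _ _ h := h.elim

/-- The disjoint union of two oriented graphs. -/
def disjUnion {V W : Type*} (G : OrientedGraph V) (H : OrientedGraph W) :
    OrientedGraph (V ⊕ W) where
  Adj
    | .inl u, .inl v => G.Adj u v
    | .inr u, .inr v => H.Adj u v
    | _, _ => False
  asymm := by
    rintro (u | u) (v | v) h
    · exact G.asymm u v h
    · exact h.elim
    · exact h.elim
    · exact H.asymm u v h

/-- The directed triangle `0 → 1 → 2 → 0`. -/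
def directedTriangle : OrientedGraph (Fin 3) where
  Adj i j := j = i + 1
  asymm := by decide

/-- The oriented graph on four vertices consisting of a directed triangle and an isolated
vertex. -/
def triangleWithIsolatedVertex : OrientedGraph (Fin 3 ⊕ Fin 1) :=
  directedTriangle.disjUnion (empty (Fin 1))

/-- The number of induced copies of `H` in `G`: the number of vertex sets of `G` that induce an
oriented graph isomorphic to `H` (such a set automatically has as many elements as `H` has
vertices). -/
noncomputable def inducedCopies {V W : Type*} (H : OrientedGraph W) (G : OrientedGraph V) : ℕ :=
  Set.ncard {S : Finset V | (G.induce S).IsIso H}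

/-- The maximum number of induced copies of `H` in an oriented graph on `n` vertices. -/
noncomputable def maxInducedCopies {W : Type*} (H : OrientedGraph W) (n : ℕ) : ℕ :=
  sSup (Set.range fun G : OrientedGraph (Fin n) => inducedCopies H G)

/-- The supremum in `maxInducedCopies` is a maximum. -/
theorem maxInducedCopies_isGreatest {W : Type*} (H : OrientedGraph W) (n : ℕ) :
    IsGreatest (Set.range fun G : OrientedGraph (Fin n) => inducedCopies H G)
      (maxInducedCopies H n) := by
  have hb : BddAbove (Set.range fun G : OrientedGraph (Fin n) => inducedCopies H G) := by
    refine ⟨Set.ncard (Set.univ : Set (Finset (Fin n))), ?_⟩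
    rintro _ ⟨G, rfl⟩
    exact Set.ncard_le_ncard (Set.subset_univ _) Set.finite_univ
  exact ⟨Nat.sSup_mem ⟨_, ⟨empty (Fin n), rfl⟩⟩ hb, fun _ hx => le_csSup hb hx⟩

/-- `H` has inducibility `c`: the maximum density of induced copies of `H` in an oriented graph
on `n` vertices converges to `c` as `n → ∞`. -/
def HasInducibility {W : Type*} [Fintype W] (H : OrientedGraph W) (c : ℝ) : Prop :=
  Tendsto (fun n : ℕ => (maxInducedCopies H n : ℝ) / (n.choose (Fintype.card W) : ℝ))
    atTop (𝓝 c)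

/-- A tournament: any two distinct vertices are joined by an arc. -/
def IsTournament {V : Type*} (G : OrientedGraph V) : Prop :=
  ∀ u v : V, u ≠ v → G.Adj u v ∨ G.Adj v u

/-- A regular tournament: a tournament in which the outdegree of every vertex equals its
indegree. -/
def IsRegularTournament {V : Type*} (G : OrientedGraph V) : Prop :=
  G.IsTournament ∧ ∀ v : V, Set.ncard {w : V | G.Adj v w} = Set.ncard {w : V | G.Adj w v}

end OrientedGraph

/-! Let `n` be the number of vertices and count labelled copies `(v, x, y, z)`: `x → y → z → x` with
`v` nonadjacent to all three. A copy has three labellings, so the upper bound `n ^ 4 / 192` on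
induced copies, which is `1/8` of `n ^ 4 / 24`, amounts to `n ^ 4 / 64` for labelled ones. The two
factors `1/8` come from separate arguments.

Inside the non-neighbourhood of a fixed `v`, at most one eighth as many ordered triples are cyclic
as span at least two arcs (`eight_mul_sum_cyclic_le`). The slack is a sum over triples plus a
multiple of the sum of squares of outdegree minus indegree.

After that only the underlying undirected graph matters: at most `n ^ 4 / 8` tuples have `v`
nonadjacent to `x`, `y`, `z` and at least two edges among these (`sum_majority_nonneighbors_le`).
This is a flag algebra certificate on five vertices: a constant minus the density minus sums of
squares is nonnegative on each graph on five labelled vertices. Summing over all maps `Fin 5 → V`,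
including the noninjective ones, leaves no lower-order error. The squares vanish on two equal
disjoint cliques, the extremal graph.

For the lower bound, a regular tournament on `a` vertices has `(a ^ 3 - a) / 8` labelled cyclic
triangles. In a disjoint union of two of them, each triangle forms a copy with each vertex of the
other side. -/

/-! ### A sum-of-squares certificate on graphs with five vertices. -/

section Certificate

/-- The vertex `0` is nonadjacent to `1`, `2`, `3`, which span at least two edges. -/
def majorityTerm (e : Fin 5 → Fin 5 → Bool) : ℤ :=
  if !e 0 1 && !e 0 2 && !e 0 3 && Bool.atLeastTwo (e 1 2) (e 2 3) (e 3 1) then 1 else 0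

/-- First quadratic form at a vertex, as a function of the three pairs of a triple. -/
def cherryForm (x y z : Bool) : ℤ :=
  -- On two equal disjoint cliques, pairs within one clique give `3` and pairs across give `-3`, so
  -- the sum over all pairs is zero.
  (if xor x y && !z then -3 else 3) - (if !x && !y && !z then 4 else 0)

/-- Second quadratic form at a vertex, as a function of the three pairs of a triple. -/
def independentForm (x y z : Bool) : ℤ :=
  if !z && (x == y) then if x then -1 else 1 else 0

/-- The difference of two indicators. -/
def indicatorDiff (x y : Bool) : ℤ :=
  if x == y then 0 else if x then 1 else -1

/-- The contribution of the squares at a vertex. -/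
def vertexTerm (e : Fin 5 → Fin 5 → Bool) : ℤ :=
  2 * (cherryForm (e 0 1) (e 0 2) (e 1 2) * cherryForm (e 0 3) (e 0 4) (e 3 4)) +
  9 * (independentForm (e 0 1) (e 0 2) (e 1 2) * independentForm (e 0 3) (e 0 4) (e 3 4))

/-- The contribution of the squares at an edge. -/
def edgeTerm (e : Fin 5 → Fin 5 → Bool) : ℤ :=
  if e 0 1 then indicatorDiff (e 0 2) (e 1 2) * indicatorDiff (e 0 3) (e 1 3) else 0

/-- Representatives of the relabellings of `majorityTerm`. -/
def majorityLabellings : List (Fin 5 → Fin 5) :=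
  [![0, 1, 2, 3, 4], ![0, 1, 2, 4, 3], ![0, 1, 3, 4, 2], ![0, 2, 3, 4, 1], ![1, 0, 2, 3, 4],
    ![1, 0, 2, 4, 3], ![1, 0, 3, 4, 2], ![1, 2, 3, 4, 0], ![2, 0, 1, 3, 4], ![2, 0, 1, 4, 3],
    ![2, 0, 3, 4, 1], ![2, 1, 3, 4, 0], ![3, 0, 1, 2, 4], ![3, 0, 1, 4, 2], ![3, 0, 2, 4, 1],
    ![3, 1, 2, 4, 0], ![4, 0, 1, 2, 3], ![4, 0, 1, 3, 2], ![4, 0, 2, 3, 1], ![4, 1, 2, 3, 0]]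

/-- Representatives of the relabellings of `vertexTerm`. -/
def vertexLabellings : List (Fin 5 → Fin 5) :=
  [![0, 1, 2, 3, 4], ![0, 1, 3, 2, 4], ![0, 1, 4, 2, 3], ![1, 0, 2, 3, 4], ![1, 0, 3, 2, 4],
    ![1, 0, 4, 2, 3], ![2, 0, 1, 3, 4], ![2, 0, 3, 1, 4], ![2, 0, 4, 1, 3], ![3, 0, 1, 2, 4],
    ![3, 0, 2, 1, 4], ![3, 0, 4, 1, 2], ![4, 0, 1, 2, 3], ![4, 0, 2, 1, 3], ![4, 0, 3, 1, 2]]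

/-- Representatives of the relabellings of `edgeTerm`. -/
def edgeLabellings : List (Fin 5 → Fin 5) :=
  [![0, 1, 2, 3, 4], ![0, 1, 2, 4, 3], ![0, 1, 3, 4, 2], ![0, 2, 1, 3, 4], ![0, 2, 1, 4, 3],
    ![0, 2, 3, 4, 1], ![0, 3, 1, 2, 4], ![0, 3, 1, 4, 2], ![0, 3, 2, 4, 1], ![0, 4, 1, 2, 3],
    ![0, 4, 1, 3, 2], ![0, 4, 2, 3, 1], ![1, 2, 0, 3, 4], ![1, 2, 0, 4, 3], ![1, 2, 3, 4, 0],
    ![1, 3, 0, 2, 4], ![1, 3, 0, 4, 2], ![1, 3, 2, 4, 0], ![1, 4, 0, 2, 3], ![1, 4, 0, 3, 2],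
    ![1, 4, 2, 3, 0], ![2, 3, 0, 1, 4], ![2, 3, 0, 4, 1], ![2, 3, 1, 4, 0], ![2, 4, 0, 1, 3],
    ![2, 4, 0, 3, 1], ![2, 4, 1, 3, 0], ![3, 4, 0, 1, 2], ![3, 4, 0, 2, 1], ![3, 4, 1, 2, 0]]

/-- The position of the pair `{i, j}` in a bit string that encodes a graph on `Fin 5`. -/
def pairIndex (i j : Fin 5) : ℕ :=
  if i.val < j.val then j.val * (j.val - 1) / 2 + i.val else i.val * (i.val - 1) / 2 + j.val

/-- The symmetrised certificate of an adjacency function. -/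
def certificate (e : Fin 5 → Fin 5 → Bool) : ℤ :=
  -- With 20, 15 and 30 labellings, the total weights are `432 * 20 = 8 * 1080` for the majority
  -- term, and 60 and 1080 for the squares; the first ratio is the bound `1/8`.
  1080 - 432 * (majorityLabellings.map fun p => majorityTerm fun i j => e (p i) (p j)).sum -
    4 * (vertexLabellings.map fun p => vertexTerm fun i j => e (p i) (p j)).sum -
    36 * (edgeLabellings.map fun p => edgeTerm fun i j => e (p i) (p j)).sum

/-- Exhaustive kernel evaluation over the `2 ^ 10` graphs on five labelled vertices. -/
theorem certificate_nonneg_of_lt (k : ℕ) (hk : k < 1024) :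
    0 ≤ certificate fun i j => k.testBit (pairIndex i j) := by
  have h : ((List.range 1024).all fun k =>
      decide (0 ≤ certificate fun i j => k.testBit (pairIndex i j))) = true := by
    decide +kernel
  simpa using List.all_eq_true.1 h k (List.mem_range.2 hk)

theorem majorityLabellings_injective : ∀ p ∈ majorityLabellings, Function.Injective p := by
  have h : ((majorityLabellings.all fun p => decide (∀ i j : Fin 5, p i = p j → i = j)) = true) := by
    decide +kernel
  intro p hp i j hij
  simpa using of_decide_eq_true (List.all_eq_true.1 h p hp) i j hij

theorem vertexLabellings_injective : ∀ p ∈ vertexLabellings, Function.Injective p := by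
  have h : ((vertexLabellings.all fun p => decide (∀ i j : Fin 5, p i = p j → i = j)) = true) := by
    decide +kernel
  intro p hp i j hij
  simpa using of_decide_eq_true (List.all_eq_true.1 h p hp) i j hij

theorem edgeLabellings_injective : ∀ p ∈ edgeLabellings, Function.Injective p := by
  have h : ((edgeLabellings.all fun p => decide (∀ i j : Fin 5, p i = p j → i = j)) = true) := by
    decide +kernel
  intro p hp i j hij
  simpa using of_decide_eq_true (List.all_eq_true.1 h p hp) i j hij

theorem length_majorityLabellings : majorityLabellings.length = 20 := rfl

theorem length_vertexLabellings : vertexLabellings.length = 15 := rfl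

theorem length_edgeLabellings : edgeLabellings.length = 30 := rfl

attribute [irreducible] majorityLabellings vertexLabellings edgeLabellings

end Certificate

/-! ### From the five-vertex certificate to a density bound for all graphs. -/

section Transport

/-- The labellings are injective, so diagonal values never enter. This matters because `pairIndex i
i` addresses a meaningless bit. -/
theorem certificate_congr {e e' : Fin 5 → Fin 5 → Bool} (h : ∀ i j, i ≠ j → e i j = e' i j) :
    certificate e = certificate e' := by
  have key : ∀ p : Fin 5 → Fin 5, Function.Injective p → ∀ i j, i ≠ j →
      e (p i) (p j) = e' (p i) (p j) := fun p hp i j hij => h _ _ (hp.ne hij)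
  have h1 : (majorityLabellings.map fun p => majorityTerm fun i j => e (p i) (p j)) =
      majorityLabellings.map fun p => majorityTerm fun i j => e' (p i) (p j) := by
    refine List.map_congr_left fun p hp => ?_
    have := key p (majorityLabellings_injective p hp)
    simp only [majorityTerm, this 0 1 (by decide), this 0 2 (by decide), this 1 2 (by decide), this 0 3 (by decide),
      this 2 3 (by decide), this 3 1 (by decide)]
  have h2 : (vertexLabellings.map fun p => vertexTerm fun i j => e (p i) (p j)) =
      vertexLabellings.map fun p => vertexTerm fun i j => e' (p i) (p j) := by
    refine List.map_congr_left fun p hp => ?_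
    have := key p (vertexLabellings_injective p hp)
    simp only [vertexTerm, this 0 1 (by decide), this 0 2 (by decide), this 1 2 (by decide), this 0 3 (by decide),
      this 0 4 (by decide), this 3 4 (by decide)]
  have h3 : (edgeLabellings.map fun p => edgeTerm fun i j => e (p i) (p j)) =
      edgeLabellings.map fun p => edgeTerm fun i j => e' (p i) (p j) := by
    refine List.map_congr_left fun p hp => ?_
    have := key p (edgeLabellings_injective p hp)
    simp only [edgeTerm, this 0 1 (by decide), this 0 2 (by decide), this 1 2 (by decide), this 0 3 (by decide),
      this 1 3 (by decide)]
  rw [certificate, certificate, h1, h2, h3]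

theorem certificate_nonneg {e : Fin 5 → Fin 5 → Bool} (he : ∀ i j, e i j = e j i) :
    0 ≤ certificate e := by
  -- The pairs `s b < t b`, listed in the order given by `pairIndex`.
  let s : Fin 10 → Fin 5 := ![0, 0, 1, 0, 1, 2, 0, 1, 2, 3]
  let t : Fin 10 → Fin 5 := ![1, 2, 2, 3, 3, 3, 4, 4, 4, 4]
  let k := Nat.ofBits fun b : Fin 10 => e (s b) (t b)
  have hk : k < 1024 := Nat.ofBits_lt_two_pow _
  have hbit : ∀ b : Fin 10, k.testBit b = e (s b) (t b) := fun b =>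
    Nat.testBit_ofBits_lt _ _ b.2
  have hpair : ∀ i j : Fin 5, i ≠ j → ∃ b : Fin 10, pairIndex i j = b ∧
      ((s b = i ∧ t b = j) ∨ (s b = j ∧ t b = i)) := by decide
  rw [certificate_congr (e' := fun i j => k.testBit (pairIndex i j))]
  · exact certificate_nonneg_of_lt k hk
  · intro i j hij
    obtain ⟨b, hb, ⟨rfl, rfl⟩ | ⟨rfl, rfl⟩⟩ := hpair i j hij
    · rw [hb, hbit]
    · rw [hb, hbit, he]

variable {V : Type*} [Fintype V]

/-- Precomposition with a permutation of `Fin 5` permutes the tuples, so every relabelling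
contributes the same total. -/
theorem sum_relabellings (L : List (Fin 5 → Fin 5)) (hL : ∀ p ∈ L, Function.Bijective p)
    (g : (Fin 5 → V) → ℤ) :
    ∑ f : Fin 5 → V, (L.map fun p => g (f ∘ p)).sum = L.length * ∑ f, g f := by
  induction L with
  | nil => simp
  | cons p L ih =>
    simp only [List.map_cons, List.sum_cons, Finset.sum_add_distrib, List.length_cons]
    rw [ih fun q hq => hL q (List.mem_cons_of_mem _ hq)]
    have := (Equiv.arrowCongr (Equiv.ofBijective p (hL p (by simp))).symm (Equiv.refl V)).sum_comp g
    have h2 : ∑ f : Fin 5 → V, g (f ∘ p) = ∑ f, g f := by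
      rw [← this]; rfl
    rw [h2]; push_cast; ring

theorem sum_fin_five (g : (Fin 5 → V) → ℤ) :
    ∑ f, g f = ∑ a, ∑ b, ∑ c, ∑ d, ∑ x, g ![a, b, c, d, x] := by
  have step : ∀ (n : ℕ) (g : (Fin (n + 1) → V) → ℤ),
      ∑ f, g f = ∑ a, ∑ f : Fin n → V, g (Matrix.vecCons a f) := by
    intro n g
    rw [← (Fin.consEquiv fun _ => V).sum_comp, Fintype.sum_prod_type]
    rfl
  simp only [step, Fintype.sum_unique]
  rfl

theorem sq_sum_sum (g : V → V → ℤ) :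
    (∑ x, ∑ y, g x y) ^ 2 = ∑ x, ∑ y, ∑ z, ∑ w, g x y * g z w := by
  simp only [sq, Finset.sum_mul]
  simp only [Finset.mul_sum]

/-- In a graph with adjacency function `e` on `n` vertices there are at most `n ^ 4 / 8` tuples
`(v, x, y, z)` such that `v` is nonadjacent to `x`, `y`, `z` and these span at least two edges. -/
theorem sum_majority_nonneighbors_le (e : V → V → Bool) (he : ∀ x y, e x y = e y x) :
    8 * ∑ v, ∑ x, ∑ y, ∑ z, (if !e v x && !e v y && !e v z &&
      Bool.atLeastTwo (e x y) (e y z) (e z x) then (1 : ℤ) else 0) ≤ (Fintype.card V : ℤ) ^ 4 := by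
  set n : ℤ := (Fintype.card V : ℤ) with hn
  set S := ∑ v, ∑ x, ∑ y, ∑ z, (if !e v x && !e v y && !e v z &&
      Bool.atLeastTwo (e x y) (e y z) (e z x) then (1 : ℤ) else 0) with hS
  let A : (Fin 5 → V) → ℤ := fun f => majorityTerm fun i j => e (f i) (f j)
  let B : (Fin 5 → V) → ℤ := fun f => vertexTerm fun i j => e (f i) (f j)
  let C : (Fin 5 → V) → ℤ := fun f => edgeTerm fun i j => e (f i) (f j)
  -- The tuple `f` need not be injective: the certificate is nonnegative for every symmetric Boolean
  -- function on `Fin 5`.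
  have hsum : 0 ≤ ∑ f : Fin 5 → V, certificate fun i j => e (f i) (f j) :=
    Finset.sum_nonneg fun f _ => certificate_nonneg fun i j => he _ _
  have hbij : ∀ L : List (Fin 5 → Fin 5), (∀ p ∈ L, Function.Injective p) →
      ∀ p ∈ L, Function.Bijective p := fun L h p hp => Finite.injective_iff_bijective.1 (h p hp)
  have hcert : ∑ f : Fin 5 → V, (certificate fun i j => e (f i) (f j)) =
      1080 * n ^ 5 - 432 * (20 * ∑ f, A f) - 4 * (15 * ∑ f, B f) - 36 * (30 * ∑ f, C f) := by
    have h1 := sum_relabellings majorityLabellings (hbij _ majorityLabellings_injective) A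
    have h2 := sum_relabellings vertexLabellings (hbij _ vertexLabellings_injective) B
    have h3 := sum_relabellings edgeLabellings (hbij _ edgeLabellings_injective) C
    rw [length_majorityLabellings] at h1
    rw [length_vertexLabellings] at h2
    rw [length_edgeLabellings] at h3
    push_cast at h1 h2 h3
    rw [← h1, ← h2, ← h3]
    simp only [certificate, Finset.sum_sub_distrib, ← Finset.mul_sum, A, B, C, Function.comp_apply,
      Finset.sum_const, Finset.card_univ, Fintype.card_pi_const, hn, nsmul_eq_mul]
    push_cast
    ring
  -- The majority term ignores the fifth vertex, which gives the factor `n`.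
  have hA : ∑ f, A f = n * S := by
    rw [sum_fin_five]
    simp only [A, majorityTerm, hS, Finset.mul_sum]
    simp [hn]
  have hB : 0 ≤ ∑ f, B f := by
    have : ∑ f, B f = ∑ v, (2 * (∑ x, ∑ y, cherryForm (e v x) (e v y) (e x y)) ^ 2 +
        9 * (∑ x, ∑ y, independentForm (e v x) (e v y) (e x y)) ^ 2) := by
      rw [sum_fin_five]
      refine Finset.sum_congr rfl fun v _ => ?_
      rw [sq_sum_sum, sq_sum_sum]
      simp only [Finset.mul_sum, ← Finset.sum_add_distrib]
      rfl
    rw [this]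
    exact Finset.sum_nonneg fun v _ => by positivity
  -- For each edge `xy`, the square of the difference of the degrees of `x` and `y`; the unused
  -- fifth vertex again gives `n`.
  have hC : 0 ≤ ∑ f, C f := by
    have : ∑ f, C f = n * ∑ x, ∑ y, (if e x y then (∑ z, indicatorDiff (e x z) (e y z)) ^ 2
        else 0) := by
      rw [sum_fin_five, Finset.mul_sum]
      refine Finset.sum_congr rfl fun x _ => ?_
      rw [Finset.mul_sum]
      refine Finset.sum_congr rfl fun y _ => ?_
      by_cases h : e x y = true
      · rw [if_pos h, sq, Finset.sum_mul_sum]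
        simp [C, edgeTerm, h, hn, Finset.mul_sum]
      · simp [C, edgeTerm, h]
    rw [this]
    refine mul_nonneg (by positivity) (Finset.sum_nonneg fun x _ => Finset.sum_nonneg fun y _ => ?_)
    split_ifs <;> positivity
  -- Dropping the squares leaves `8640 * n * S ≤ 1080 * n ^ 5`.
  have key : n * (8 * S) ≤ n * n ^ 4 := by rw [hcert] at hsum; nlinarith
  rcases isEmpty_or_nonempty V with hV | hV
  · simp [hS, hn]
  · exact le_of_mul_le_mul_left key (by rw [hn]; exact_mod_cast Fintype.card_pos)

end Transport

/-! ### Cyclic triangles against triples spanning at least two arcs. -/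

section Triples

variable {V : Type*} [Fintype V]

theorem sum_nonneg_of_symmetrized (F : V → V → V → ℤ)
    (h : ∀ x y z, 0 ≤ F x y z + F y z x + F z x y + F x z y + F z y x + F y x z) :
    0 ≤ ∑ x, ∑ y, ∑ z, F x y z := by
  have hs : 0 ≤ ∑ x, ∑ y, ∑ z, (F x y z + F y z x + F z x y + F x z y + F z y x + F y x z) :=
    Finset.sum_nonneg fun x _ => Finset.sum_nonneg fun y _ => Finset.sum_nonneg fun z _ => h x y z
  simp only [Finset.sum_add_distrib] at hs
  have swap23 : ∀ g : V → V → V → ℤ, ∑ x, ∑ y, ∑ z, g x z y = ∑ x, ∑ y, ∑ z, g x y z :=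
    fun g => Finset.sum_congr rfl fun x _ => Finset.sum_comm
  have swap12 : ∀ g : V → V → V → ℤ, ∑ x, ∑ y, ∑ z, g y x z = ∑ x, ∑ y, ∑ z, g x y z :=
    fun g => Finset.sum_comm
  have h1 := (swap12 fun x y z => F x z y).trans (swap23 F)
  have h2 := (swap23 fun x y z => F y x z).trans (swap12 F)
  have h3 := (swap12 fun x y z => F z x y).trans h2
  rw [h1, h2, h3, swap23 F, swap12 F] at hs
  linarith

/-- A weight on triples of vertices of an oriented graph, as a function of the arcs
`x → y`, `y → z`, `z → x` and of their reversals. -/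
def triangleWeight (a b c a' b' c' : Bool) : ℤ :=
  (if Bool.atLeastTwo (a || a') (b || b') (c || c') then 1 else 0) -
    8 * (if a && b && c then 1 else 0) - 3 * (indicatorDiff a a' * indicatorDiff c' c)

/-- The symmetrised weight is `6 - 24 + 18 = 0` on a cyclic and `6 - 6 = 0` on a transitive
triangle. With two arcs it is `12` on a directed path and `0` otherwise; with fewer arcs it
vanishes. -/
theorem triangleWeight_symmetrized_nonneg : ∀ a b c a' b' c' : Bool,
    !(a && a') → !(b && b') → !(c && c') →
    0 ≤ triangleWeight a b c a' b' c' + triangleWeight b c a b' c' a' +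
      triangleWeight c a b c' a' b' + triangleWeight c' b' a' c b a +
      triangleWeight b' a' c' b a c + triangleWeight a' c' b' a c b := by decide

/-- In a weighted oriented graph with arc function `r`, eight times the number of labelled cyclic
triangles is at most the number of ordered triples that span at least two arcs. -/
theorem eight_mul_sum_cyclic_le (r : V → V → Bool) (hr : ∀ x y, !(r x y && r y x)) (w : V → ℤ)
    (hw : ∀ x, 0 ≤ w x) :
    8 * ∑ x, ∑ y, ∑ z, w x * (w y * (w z * if r x y && r y z && r z x then 1 else 0)) ≤
      ∑ x, ∑ y, ∑ z, w x * (w y * (w z * if Bool.atLeastTwo (r x y || r y x) (r y z || r z y)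
        (r z x || r x z) then 1 else 0)) := by
  have key := sum_nonneg_of_symmetrized (fun x y z => w x * (w y * (w z *
      triangleWeight (r x y) (r y z) (r z x) (r y x) (r z y) (r x z)))) (by
    intro x y z
    have hw3 : 0 ≤ w x * (w y * w z) := mul_nonneg (hw x) (mul_nonneg (hw y) (hw z))
    refine (mul_nonneg hw3 (triangleWeight_symmetrized_nonneg _ _ _ _ _ _ (hr x y) (hr y z)
      (hr z x))).trans_eq ?_
    ring)
  -- At each `x` this is `w x` times the square of weighted outdegree minus weighted indegree.
  have hsq : 0 ≤ ∑ x, ∑ y, ∑ z,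
      w x * (w y * (w z * (indicatorDiff (r x y) (r y x) * indicatorDiff (r x z) (r z x)))) := by
    refine Finset.sum_nonneg fun x _ => ?_
    have : ∑ y, ∑ z, w x * (w y * (w z *
        (indicatorDiff (r x y) (r y x) * indicatorDiff (r x z) (r z x)))) =
        w x * (∑ y, w y * indicatorDiff (r x y) (r y x)) ^ 2 := by
      rw [sq, Finset.sum_mul_sum, Finset.mul_sum]
      refine Finset.sum_congr rfl fun y _ => ?_
      rw [Finset.mul_sum]
      exact Finset.sum_congr rfl fun z _ => by ring
    rw [this]
    exact mul_nonneg (hw x) (sq_nonneg _)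
  have hsplit : ∑ x, ∑ y, ∑ z, w x * (w y * (w z *
      triangleWeight (r x y) (r y z) (r z x) (r y x) (r z y) (r x z))) =
      ∑ x, ∑ y, ∑ z, w x * (w y * (w z * if Bool.atLeastTwo (r x y || r y x) (r y z || r z y)
        (r z x || r x z) then 1 else 0)) -
      8 * ∑ x, ∑ y, ∑ z, w x * (w y * (w z * if r x y && r y z && r z x then 1 else 0)) -
      3 * ∑ x, ∑ y, ∑ z,
      w x * (w y * (w z * (indicatorDiff (r x y) (r y x) * indicatorDiff (r x z) (r z x)))) := by
    simp only [Finset.mul_sum, ← Finset.sum_sub_distrib]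
    refine Finset.sum_congr rfl fun x _ => Finset.sum_congr rfl fun y _ =>
      Finset.sum_congr rfl fun z _ => ?_
    rw [triangleWeight]
    ring
  linarith

end Triples

/-! ### The upper bound for labelled copies. -/

namespace OrientedGraph

variable {V : Type*}

theorem irrefl (G : OrientedGraph V) (x : V) : ¬ G.Adj x x := fun h => G.asymm x x h h

/-- The vertices `x → y → z → x` form a directed triangle all of whose vertices are nonadjacent
to `v`. -/
def IsCopyAt (G : OrientedGraph V) (v x y z : V) : Prop :=
  (G.Adj x y ∧ G.Adj y z ∧ G.Adj z x) ∧
    (¬ G.Adj v x ∧ ¬ G.Adj x v) ∧ (¬ G.Adj v y ∧ ¬ G.Adj y v) ∧ (¬ G.Adj v z ∧ ¬ G.Adj z v)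

theorem IsCopyAt.rotate {G : OrientedGraph V} {v x y z : V} (h : G.IsCopyAt v x y z) :
    G.IsCopyAt v y z x := by
  obtain ⟨⟨h1, h2, h3⟩, h4, h5, h6⟩ := h
  exact ⟨⟨h2, h3, h1⟩, h5, h6, h4⟩

section Labelled

variable [Fintype V]

open Classical in
/-- The number of labelled induced copies of a directed triangle with an isolated vertex. -/
noncomputable def labelledCopies (G : OrientedGraph V) : ℤ :=
  ∑ v, ∑ x, ∑ y, ∑ z, if G.IsCopyAt v x y z then 1 else 0

theorem labelledCopies_le (G : OrientedGraph V) :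
    64 * G.labelledCopies ≤ (Fintype.card V : ℤ) ^ 4 := by
  classical
  let r : V → V → Bool := fun x y => decide (G.Adj x y)
  let e : V → V → Bool := fun x y => r x y || r y x
  have hr : ∀ x y, !(r x y && r y x) := by
    intro x y
    have := G.asymm x y
    simp only [r, Bool.not_and, Bool.or_eq_true, Bool.not_eq_true', decide_eq_false_iff_not]
    tauto
  have hmaj := sum_majority_nonneighbors_le e fun x y => Bool.or_comm _ _
  have hcyc : 8 * G.labelledCopies ≤ ∑ v, ∑ x, ∑ y, ∑ z,
      (if !e v x && !e v y && !e v z && Bool.atLeastTwo (e x y) (e y z) (e z x) then (1 : ℤ)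
        else 0) := by
    rw [labelledCopies, Finset.mul_sum]
    refine Finset.sum_le_sum fun v _ => ?_
    -- The weight is the indicator of the non-neighbourhood of `v`.
    have h := eight_mul_sum_cyclic_le r hr (fun x => if e v x then 0 else 1)
      fun x => by split_ifs <;> simp
    refine (le_of_eq ?_).trans (h.trans (le_of_eq ?_))
    · congr 1
      refine Finset.sum_congr rfl fun x _ => Finset.sum_congr rfl fun y _ =>
        Finset.sum_congr rfl fun z _ => ?_
      have hiff : G.IsCopyAt v x y z ↔ e v x = false ∧ e v y = false ∧ e v z = false ∧
          (r x y && r y z && r z x) = true := by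
        simp only [IsCopyAt, e, r, Bool.or_eq_false_iff, Bool.and_eq_true, decide_eq_true_eq,
          decide_eq_false_iff_not]
        tauto
      simp only [hiff]
      cases e v x <;> cases e v y <;> cases e v z <;> simp
    · refine Finset.sum_congr rfl fun x _ => Finset.sum_congr rfl fun y _ =>
        Finset.sum_congr rfl fun z _ => ?_
      cases e v x <;> cases e v y <;> cases e v z <;> simp [e]
  linarith

end Labelled

end OrientedGraph

/-! ### Labelled copies and vertex sets inducing a copy. -/

namespace OrientedGraph

variable {V : Type*}

theorem IsCopyAt.ne {G : OrientedGraph V} {v x y z : V} (h : G.IsCopyAt v x y z) :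
    (v ≠ x ∧ v ≠ y ∧ v ≠ z) ∧ x ≠ y ∧ y ≠ z ∧ z ≠ x := by
  obtain ⟨⟨h1, h2, h3⟩, h4, h5, h6⟩ := h
  refine ⟨⟨?_, ?_, ?_⟩, ?_, ?_, ?_⟩ <;> rintro rfl
  exacts [h6.2 h3, h4.2 h1, h5.2 h2, G.irrefl _ h1, G.irrefl _ h2, G.irrefl _ h3]

theorem isIso_triangleWithIsolatedVertex_iff [DecidableEq V] (G : OrientedGraph V) (S : Finset V) :
    (G.induce S).IsIso triangleWithIsolatedVertex ↔
      ∃ v x y z, G.IsCopyAt v x y z ∧ ({v, x, y, z} : Finset V) = S := by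
  constructor
  · rintro ⟨φ⟩
    have hadj : ∀ i j, G.Adj (φ.symm i) (φ.symm j) ↔ triangleWithIsolatedVertex.Adj i j :=
      fun i j => φ.symm.map_rel_iff
    refine ⟨φ.symm (.inr 0), φ.symm (.inl 0), φ.symm (.inl 1), φ.symm (.inl 2), ?_, ?_⟩
    · simp only [IsCopyAt, hadj]
      simp [triangleWithIsolatedVertex, disjUnion, directedTriangle]
    · ext s
      simp only [Finset.mem_insert, Finset.mem_singleton]
      constructor
      · rintro (rfl | rfl | rfl | rfl) <;> exact Subtype.coe_prop _
      · intro hs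
        obtain ⟨i, hi⟩ := φ.symm.surjective ⟨s, hs⟩
        have hi' : s = φ.symm i := by rw [hi]
        rw [hi']
        rcases i with i | i <;> fin_cases i <;> simp
  · rintro ⟨v, x, y, z, h, rfl⟩
    have hne := h.ne
    let f : Fin 3 ⊕ Fin 1 → ({v, x, y, z} : Finset V) :=
      Sum.elim ![⟨x, by simp⟩, ⟨y, by simp⟩, ⟨z, by simp⟩] ![⟨v, by simp⟩]
    have hf : Function.Bijective f := by
      constructor
      · rintro (i | i) (j | j) <;> fin_cases i <;> fin_cases j <;> simp [f] <;> grind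
      · rintro ⟨s, hs⟩
        simp only [Finset.mem_insert, Finset.mem_singleton] at hs
        rcases hs with rfl | rfl | rfl | rfl
        exacts [⟨.inr 0, rfl⟩, ⟨.inl 0, rfl⟩, ⟨.inl 1, rfl⟩, ⟨.inl 2, rfl⟩]
    refine ⟨RelIso.symm ⟨Equiv.ofBijective f hf, ?_⟩⟩
    obtain ⟨⟨h1, h2, h3⟩, h4, h5, h6⟩ := h
    have h1' := G.asymm _ _ h1
    have h2' := G.asymm _ _ h2
    have h3' := G.asymm _ _ h3
    rintro (i | i) (j | j) <;> fin_cases i <;> fin_cases j <;>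
      simp [f, induce, triangleWithIsolatedVertex, disjUnion, directedTriangle, empty, G.irrefl, *]

/-- The set determines `v` as its only vertex without neighbours in it, and the triangle up to
rotation because each of its vertices has a unique out-neighbour in the set. -/
theorem IsCopyAt.eq_of_insert_eq [DecidableEq V] {G : OrientedGraph V} {v x y z v' x' y' z' : V}
    (h : G.IsCopyAt v x y z) (h' : G.IsCopyAt v' x' y' z')
    (hS : ({v', x', y', z'} : Finset V) = {v, x, y, z}) :
    v' = v ∧ (x' = x ∧ y' = y ∧ z' = z ∨ x' = y ∧ y' = z ∧ z' = x ∨ x' = z ∧ y' = x ∧ z' = y) := by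
  have rot : ∀ {p a b c : Prop}, p ∨ a ∨ b ∨ c → p ∨ b ∨ c ∨ a := by tauto
  have hx : ∀ s, s ∈ ({v, x, y, z} : Finset V) ↔ s = v' ∨ s = x' ∨ s = y' ∨ s = z' := by
    intro s; rw [← hS]; simp
  have hx' : ∀ s, s ∈ ({v', x', y', z'} : Finset V) → s = v ∨ s = x ∨ s = y ∨ s = z := by
    intro s; rw [hS]; simp
  have mx := (hx x).1 (by simp)
  have my := (hx y).1 (by simp)
  have mz := (hx z).1 (by simp)
  have mv' := hx' v' (by simp)
  have mx' := hx' x' (by simp)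
  have my' := hx' y' (by simp)
  have mz' := hx' z' (by simp)
  obtain ⟨⟨h1, h2, h3⟩, h4, h5, h6⟩ := h
  obtain ⟨⟨h1', h2', h3'⟩, h4', h5', h6'⟩ := h'
  have i := G.irrefl
  have as := G.asymm
  -- If `v'` were on the triangle `x y z`, its successor would lie in `{v', x', y', z'}` and be
  -- adjacent to `v'`, which is impossible.
  have hv : v' = v := by
    rcases mv' with rfl | rfl | rfl | rfl
    · rfl
    · rcases my with rfl | rfl | rfl | rfl <;> simp_all
    · rcases mz with rfl | rfl | rfl | rfl <;> simp_all
    · rcases mx with rfl | rfl | rfl | rfl <;> simp_all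
  refine ⟨hv, ?_⟩
  subst hv
  have next : ∀ a b c s t, G.Adj a b → G.Adj b c → G.Adj c a → ¬ G.Adj a v' → s = a → G.Adj s t →
      (t = v' ∨ t = a ∨ t = b ∨ t = c) → t = b := by
    rintro a b c s t hab hbc hca hav rfl hst (rfl | rfl | rfl | rfl)
    exacts [(hav hst).elim, (i _ hst).elim, rfl, (as _ _ hst hca).elim]
  rcases mx' with e | e | e | e
  · rw [e] at h1'
    rcases my' with e' | e' | e' | e' <;> rw [e'] at h1'
    exacts [(i _ h1').elim, (h4.1 h1').elim, (h5.1 h1').elim, (h6.1 h1').elim]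
  · have hy := next x y z x' y' h1 h2 h3 h4.2 e h1' my'
    have hz := next y z x y' z' h2 h3 h1 h5.2 hy h2' (rot mz')
    exact .inl ⟨e, hy, hz⟩
  · have hy := next y z x x' y' h2 h3 h1 h5.2 e h1' (rot my')
    have hz := next z x y y' z' h3 h1 h2 h6.2 hy h2' (rot (rot mz'))
    exact .inr (.inl ⟨e, hy, hz⟩)
  · have hy := next z x y x' y' h3 h1 h2 h6.2 e h1' (rot (rot my'))
    have hz := next x y z y' z' h1 h2 h3 h4.2 hy h2' mz'
    exact .inr (.inr ⟨e, hy, hz⟩)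

theorem three_mul_inducedCopies [Fintype V] (G : OrientedGraph V) :
    3 * (inducedCopies triangleWithIsolatedVertex G : ℤ) = G.labelledCopies := by
  classical
  let X : Finset (V × V × V × V) :=
    Finset.univ.filter fun q => G.IsCopyAt q.1 q.2.1 q.2.2.1 q.2.2.2
  let π : V × V × V × V → Finset V := fun q => {q.1, q.2.1, q.2.2.1, q.2.2.2}
  have hset : {S : Finset V | (G.induce S).IsIso triangleWithIsolatedVertex} = ↑(X.image π) := by
    ext S
    simp [isIso_triangleWithIsolatedVertex_iff, X, π]
  have hX : G.labelledCopies = X.card := by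
    simp only [labelledCopies, X, Finset.card_filter, Fintype.sum_prod_type]
    push_cast
    rfl
  have hfib : ∀ S ∈ X.image π, (X.filter fun q => π q = S).card = 3 := by
    intro S hS
    obtain ⟨⟨v, x, y, z⟩, hq, rfl⟩ := Finset.mem_image.1 hS
    have h : G.IsCopyAt v x y z := (Finset.mem_filter.1 hq).2
    have : X.filter (fun q => π q = π (v, x, y, z)) =
        {(v, x, y, z), (v, y, z, x), (v, z, x, y)} := by
      ext ⟨v', x', y', z'⟩
      simp only [Finset.mem_filter, Finset.mem_univ, true_and, X, π, Finset.mem_insert,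
        Finset.mem_singleton, Prod.mk.injEq]
      constructor
      · rintro ⟨h', hS⟩
        have := h.eq_of_insert_eq h' hS
        tauto
      · rintro (⟨rfl, rfl, rfl, rfl⟩ | ⟨rfl, rfl, rfl, rfl⟩ | ⟨rfl, rfl, rfl, rfl⟩)
        · exact ⟨h, rfl⟩
        · exact ⟨h.rotate, by ext; simp; tauto⟩
        · exact ⟨h.rotate.rotate, by ext; simp; tauto⟩
    obtain ⟨-, hxy, hyz, hzx⟩ := h.ne
    rw [this, Finset.card_insert_of_notMem, Finset.card_insert_of_notMem, Finset.card_singleton]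
    · simp [hyz]
    · simp [hxy, hzx.symm]
  rw [inducedCopies, hset, Set.ncard_coe_finset, hX,
    Finset.card_eq_sum_card_fiberwise (f := π) (t := X.image π)
      fun q hq => Finset.mem_coe.2 (Finset.mem_image_of_mem _ hq), Finset.sum_congr rfl hfib]
  simp [mul_comm]

theorem inducedCopies_triangleWithIsolatedVertex_le [Fintype V] (G : OrientedGraph V) :
    192 * inducedCopies triangleWithIsolatedVertex G ≤ Fintype.card V ^ 4 := by
  have h1 := G.three_mul_inducedCopies
  have h2 := G.labelledCopies_le
  have : 192 * (inducedCopies triangleWithIsolatedVertex G : ℤ) ≤ (Fintype.card V : ℤ) ^ 4 := by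
    linarith
  exact_mod_cast this

end OrientedGraph

/-! ### Cyclic triangles in regular tournaments and the lower bound for disjoint unions. -/

namespace OrientedGraph

section Triangles

variable {V W : Type*} [Fintype V] [Fintype W]

open Classical in
/-- The indicator of the arcs of an oriented graph. -/
noncomputable def arcIndicator (G : OrientedGraph V) (x y : V) : ℤ := if G.Adj x y then 1 else 0

/-- The number of labelled directed triangles. -/
noncomputable def labelledTriangles (G : OrientedGraph V) : ℤ :=
  ∑ x, ∑ y, ∑ z, G.arcIndicator x y * G.arcIndicator y z * G.arcIndicator z x

theorem IsRegularTournament.two_mul_sum_arcIndicator {G : OrientedGraph V}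
    (hG : G.IsRegularTournament) (x : V) :
    2 * ∑ y, G.arcIndicator x y = Fintype.card V - 1 ∧
      2 * ∑ y, G.arcIndicator y x = Fintype.card V - 1 := by
  classical
  have hsum : ∑ y, G.arcIndicator x y + ∑ y, G.arcIndicator y x = Fintype.card V - 1 := by
    rw [← Finset.sum_add_distrib]
    have : ∀ y, G.arcIndicator x y + G.arcIndicator y x = 1 - if y = x then 1 else 0 := by
      intro y
      rcases eq_or_ne y x with rfl | h
      · simp [arcIndicator, G.irrefl]
      · have h1 := hG.1 x y h.symm
        have h2 := G.asymm x y
        by_cases h3 : G.Adj x y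
        · simp [arcIndicator, h3, h2 h3, h]
        · simp [arcIndicator, h3, h1.resolve_left h3, h]
    simp [this]
  have heq : ∑ y, G.arcIndicator x y = ∑ y, G.arcIndicator y x := by
    have := hG.2 x
    rw [Set.ncard_eq_toFinset_card', Set.ncard_eq_toFinset_card'] at this
    simp only [arcIndicator, Finset.sum_boole]
    simpa using this
  constructor <;> linarith

/-- Every directed path `x → y → z` closes to a cyclic or a transitive triangle. Paths are counted
at their middle vertex and transitive triangles at their source; both counts depend only on the
degrees. -/
theorem IsRegularTournament.eight_mul_labelledTriangles {G : OrientedGraph V}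
    (hG : G.IsRegularTournament) :
    8 * G.labelledTriangles = (Fintype.card V : ℤ) ^ 3 - Fintype.card V := by
  classical
  set A := G.arcIndicator with hA
  set n : ℤ := (Fintype.card V : ℤ) with hn
  have hout : ∀ x, 2 * ∑ y, A x y = n - 1 := fun x => (hG.two_mul_sum_arcIndicator x).1
  have hin : ∀ x, 2 * ∑ y, A y x = n - 1 := fun x => (hG.two_mul_sum_arcIndicator x).2
  have hadd : ∀ x y, A x y + A y x = 1 - if x = y then 1 else 0 := by
    intro x y
    rcases eq_or_ne x y with rfl | h
    · simp [hA, arcIndicator, G.irrefl]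
    · have h1 := hG.1 x y h
      have h2 := G.asymm x y
      by_cases h3 : G.Adj x y
      · simp [hA, arcIndicator, h3, h2 h3, h]
      · simp [hA, arcIndicator, h3, h1.resolve_left h3, h]
  have hmul : ∀ x y, A x y * A y x = 0 := by
    intro x y
    have h2 := G.asymm x y
    by_cases h3 : G.Adj x y <;> simp [hA, arcIndicator, h3, h2]
  have hsq : ∀ x y, A x y * A x y = A x y := by
    intro x y
    by_cases h3 : G.Adj x y <;> simp [hA, arcIndicator, h3]
  set U := ∑ x, ∑ y, ∑ z, A x y * A y z * A x z with hU
  -- Paths with two arcs; those with `x = z` vanish by `hmul`.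
  have h1 : 4 * (G.labelledTriangles + U) = n * (n - 1) ^ 2 := by
    have e1 : G.labelledTriangles + U = ∑ x, ∑ y, ∑ z, A x y * A y z := by
      simp only [labelledTriangles, hU, ← Finset.sum_add_distrib]
      refine Finset.sum_congr rfl fun x _ => Finset.sum_congr rfl fun y _ => ?_
      have : ∀ z, A x y * A y z * A z x + A x y * A y z * A x z =
          A x y * A y z - if x = z then A x y * A y z else 0 := by
        intro z
        have := hadd x z
        split_ifs at this ⊢ <;> linear_combination (A x y * A y z) * this
      rw [← hA, Finset.sum_congr rfl fun z _ => this z]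
      simp [hmul]
    have e2 : ∑ x, ∑ y, ∑ z, A x y * A y z = ∑ y, (∑ x, A x y) * ∑ z, A y z := by
      rw [Finset.sum_comm]
      exact Finset.sum_congr rfl fun y _ => by rw [Finset.sum_mul_sum]
    rw [e1, e2, Finset.mul_sum]
    calc ∑ y, 4 * ((∑ x, A x y) * ∑ z, A y z) = ∑ y : V, (n - 1) ^ 2 :=
          Finset.sum_congr rfl fun y _ => by
            linear_combination (2 * ∑ z, A y z) * hin y + (n - 1) * hout y
      _ = n * (n - 1) ^ 2 := by simp [hn]
  have h2 : 8 * U = n * (n - 1) ^ 2 - 2 * (n * (n - 1)) := by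
    -- Exchanging `y` and `z` in a second copy of `U` counts ordered pairs of distinct
    -- out-neighbours of `x`, since exactly one arc joins them.
    have e1 : 2 * U = ∑ x, ((∑ y, A x y) * ∑ z, A x z - ∑ y, A x y) := by
      have e3 : U = ∑ x, ∑ y, ∑ z, A x y * A z y * A x z := by
        refine Finset.sum_congr rfl fun x _ => ?_
        rw [Finset.sum_comm]
        exact Finset.sum_congr rfl fun y _ => Finset.sum_congr rfl fun z _ => by ring
      rw [two_mul]
      nth_rw 2 [e3]
      simp only [hU, ← Finset.sum_add_distrib]
      refine Finset.sum_congr rfl fun x _ => ?_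
      rw [Finset.sum_mul_sum, ← Finset.sum_sub_distrib]
      refine Finset.sum_congr rfl fun y _ => ?_
      have : ∀ z, A x y * A y z * A x z + A x y * A z y * A x z =
          A x y * A x z - if y = z then A x y * A x z else 0 := by
        intro z
        have := hadd y z
        split_ifs at this ⊢ <;> linear_combination (A x y * A x z) * this
      simp [this, hsq]
    have : 4 * (2 * U) = ∑ x : V, ((n - 1) ^ 2 - 2 * (n - 1)) := by
      rw [e1, Finset.mul_sum]
      exact Finset.sum_congr rfl fun x _ => by
        linear_combination (2 * ∑ y, A x y + n - 1 - 2) * hout x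
    rw [Finset.sum_const, Finset.card_univ, nsmul_eq_mul] at this
    linear_combination this
  linear_combination 2 * h1 - h2

theorem le_labelledCopies_disjUnion (G : OrientedGraph V) (H : OrientedGraph W) :
    Fintype.card W * G.labelledTriangles + Fintype.card V * H.labelledTriangles ≤
      (G.disjUnion H).labelledCopies := by
  classical
  have hl : ∀ f : V ⊕ W → ℤ, (∀ i, 0 ≤ f i) → ∑ i, f (.inl i) ≤ ∑ i, f i := by
    intro f hf
    rw [Fintype.sum_sum_type]
    exact le_add_of_nonneg_right (Finset.sum_nonneg fun i _ => hf _)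
  have hr : ∀ f : V ⊕ W → ℤ, (∀ i, 0 ≤ f i) → ∑ i, f (.inr i) ≤ ∑ i, f i := by
    intro f hf
    rw [Fintype.sum_sum_type]
    exact le_add_of_nonneg_left (Finset.sum_nonneg fun i _ => hf _)
  have h0 : ∀ v x y z, (0 : ℤ) ≤ if (G.disjUnion H).IsCopyAt v x y z then 1 else 0 := by
    intro v x y z; split_ifs <;> simp
  rw [labelledCopies, Fintype.sum_sum_type, add_comm]
  refine add_le_add ?_ ?_
  · rw [← nsmul_eq_mul, ← Finset.card_univ, ← Finset.sum_const]
    refine Finset.sum_le_sum fun v _ => ?_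
    refine le_trans ?_ (hr _ fun x => Finset.sum_nonneg fun y _ =>
      Finset.sum_nonneg fun z _ => h0 _ _ _ _)
    refine Finset.sum_le_sum fun x _ => ?_
    refine le_trans ?_ (hr _ fun y => Finset.sum_nonneg fun z _ => h0 _ _ _ _)
    refine Finset.sum_le_sum fun y _ => ?_
    refine le_trans (le_of_eq ?_) (hr _ fun z => h0 _ _ _ _)
    refine Finset.sum_congr rfl fun z _ => ?_
    simp only [IsCopyAt, disjUnion, arcIndicator, ← ite_and, mul_ite, mul_one, mul_zero]
    simp [and_comm, and_assoc]
  · rw [← nsmul_eq_mul, ← Finset.card_univ, ← Finset.sum_const]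
    refine Finset.sum_le_sum fun v _ => ?_
    refine le_trans ?_ (hl _ fun x => Finset.sum_nonneg fun y _ =>
      Finset.sum_nonneg fun z _ => h0 _ _ _ _)
    refine Finset.sum_le_sum fun x _ => ?_
    refine le_trans ?_ (hl _ fun y => Finset.sum_nonneg fun z _ => h0 _ _ _ _)
    refine Finset.sum_le_sum fun y _ => ?_
    refine le_trans (le_of_eq ?_) (hl _ fun z => h0 _ _ _ _)
    refine Finset.sum_congr rfl fun z _ => ?_
    simp only [IsCopyAt, disjUnion, arcIndicator, ← ite_and, mul_ite, mul_one, mul_zero]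
    simp [and_comm, and_assoc]

theorem IsRegularTournament.le_inducedCopies_disjUnion {G : OrientedGraph V}
    {H : OrientedGraph W} (hG : G.IsRegularTournament) (hH : H.IsRegularTournament) :
    (Fintype.card V : ℤ) * Fintype.card W *
      ((Fintype.card V : ℤ) ^ 2 + (Fintype.card W : ℤ) ^ 2 - 2) ≤
      24 * inducedCopies triangleWithIsolatedVertex (G.disjUnion H) := by
  have h1 := hG.eight_mul_labelledTriangles
  have h2 := hH.eight_mul_labelledTriangles
  have h3 := le_labelledCopies_disjUnion G H
  have h4 := (G.disjUnion H).three_mul_inducedCopies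
  linear_combination 8 * h3 - 8 * h4 - (Fintype.card W : ℤ) * h1 - (Fintype.card V : ℤ) * h2

end Triangles

/-! ### Adding isolated vertices, and circulant tournaments. -/

section Constructions

variable {V W : Type*}

/-- The oriented graph on `W` obtained from `G` by adding isolated vertices. -/
def extend (f : V ↪ W) (G : OrientedGraph V) : OrientedGraph W where
  Adj u v := ∃ x y, f x = u ∧ f y = v ∧ G.Adj x y
  asymm := by
    rintro _ _ ⟨x, y, rfl, rfl, h⟩ ⟨x', y', h1, h2, h'⟩
    rw [f.injective h1, f.injective h2] at h'
    exact G.asymm _ _ h h'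

theorem extend_adj (f : V ↪ W) (G : OrientedGraph V) (x y : V) :
    (G.extend f).Adj (f x) (f y) ↔ G.Adj x y := by
  constructor
  · rintro ⟨x', y', h1, h2, h⟩
    rwa [f.injective h1, f.injective h2] at h
  · exact fun h => ⟨x, y, rfl, rfl, h⟩

theorem inducedCopies_le_extend [Fintype W] (f : V ↪ W) (G : OrientedGraph V) :
    inducedCopies triangleWithIsolatedVertex G ≤
      inducedCopies triangleWithIsolatedVertex (G.extend f) := by
  classical
  refine Set.ncard_le_ncard_of_injOn (Finset.map f) ?_ (Finset.map_injective f).injOn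
    (Set.toFinite _)
  intro S hS
  obtain ⟨v, x, y, z, h, rfl⟩ := (isIso_triangleWithIsolatedVertex_iff G S).1 hS
  refine (isIso_triangleWithIsolatedVertex_iff _ _).2 ⟨f v, f x, f y, f z, ?_, ?_⟩
  · simpa only [IsCopyAt, extend_adj] using h
  · simp [Finset.map_insert]

/-- The circulant tournament on `2 * k + 1` vertices. -/
def circulant (k : ℕ) : OrientedGraph (ZMod (2 * k + 1)) where
  Adj i j := j ≠ i ∧ (j - i).val ≤ k
  asymm := by
    rintro i j ⟨h, h1⟩ ⟨-, h2⟩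
    have hne : NeZero (j - i) := ⟨sub_ne_zero.2 h⟩
    rw [← neg_sub, ZMod.val_neg_of_ne_zero] at h2
    have := ZMod.val_lt (j - i)
    omega

/-- For `d ≠ 0` exactly one of `d` and `-d` has residue at most `k`, and the reflection `w ↦ 2 * v -
w` exchanges the out- and in-neighbours of `v`. -/
theorem isRegularTournament_circulant (k : ℕ) : (circulant k).IsRegularTournament := by
  constructor
  · intro i j h
    have hne : NeZero (j - i) := ⟨sub_ne_zero.2 h.symm⟩
    by_cases h1 : (j - i).val ≤ k
    · exact .inl ⟨h.symm, h1⟩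
    · refine .inr ⟨h, ?_⟩
      rw [← neg_sub, ZMod.val_neg_of_ne_zero]
      omega
  · intro v
    refine Set.ncard_congr (fun w _ => v - (w - v)) ?_ ?_ ?_
    · rintro w ⟨h1, h2⟩
      refine ⟨?_, ?_⟩
      · intro h
        exact h1 (sub_eq_zero.1 (by linear_combination h))
      · rwa [sub_sub_cancel]
    · intro w w' _ _ h
      simpa using h
    · rintro w ⟨h1, h2⟩
      refine ⟨v - (w - v), ⟨?_, ?_⟩, by ring⟩
      · intro h
        exact h1 (by linear_combination h)
      · convert h2 using 2
        ring

end Constructions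

end OrientedGraph

/-! ### Passage to the limit. -/

section Limits

theorem tendsto_pow_four_div_choose :
    Tendsto (fun n : ℕ => (n : ℝ) ^ 4 / (n.choose 4 : ℝ)) atTop (𝓝 24) := by
  have h := isEquivalent_choose 4
  rw [Asymptotics.isEquivalent_iff_tendsto_one] at h
  · have h2 := (h.inv₀ one_ne_zero).const_mul 24
    simp only [inv_one, mul_one] at h2
    refine h2.congr fun n => ?_
    simp [Nat.factorial]
    ring
  · filter_upwards [eventually_gt_atTop 0] with n hn
    positivity

/-- Shared by both limits: `N / n ^ 4` is squeezed between `c / 24` and `1 / 192`, and `n ^ 4` is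
asymptotic to 24 times the binomial coefficient. -/
theorem tendsto_div_choose_of_squeeze {n N : ℕ → ℕ} {c : ℕ → ℝ} (hn : Tendsto n atTop atTop)
    (hN : ∀ k, 192 * N k ≤ n k ^ 4) (hc : Tendsto c atTop (𝓝 (1 / 8)))
    (hcN : ∀ᶠ k in atTop, c k * (n k : ℝ) ^ 4 ≤ 24 * N k) :
    Tendsto (fun k => (N k : ℝ) / ((n k).choose 4 : ℝ)) atTop (𝓝 (1 / 8)) := by
  have hpos : ∀ᶠ k in atTop, 0 < n k := hn.eventually_gt_atTop 0
  have hratio : Tendsto (fun k => (N k : ℝ) / (n k : ℝ) ^ 4) atTop (𝓝 (1 / 192)) := by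
    have hc' : Tendsto (fun k => c k / 24) atTop (𝓝 (1 / 192)) := by
      convert hc.div_const 24 using 2
      norm_num
    refine tendsto_of_tendsto_of_tendsto_of_le_of_le' hc' tendsto_const_nhds ?_ ?_
    · filter_upwards [hpos, hcN] with k h1 h2
      rw [le_div_iff₀ (by positivity)]
      linarith
    · filter_upwards [hpos] with k h1
      rw [div_le_iff₀ (by positivity)]
      have : (192 * N k : ℝ) ≤ (n k : ℝ) ^ 4 := by exact_mod_cast hN k
      linarith
  have h := hratio.mul (tendsto_pow_four_div_choose.comp hn)
  rw [show (1 / 192 * 24 : ℝ) = 1 / 8 by norm_num] at h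
  refine h.congr' ?_
  filter_upwards [hpos] with k h1
  simp only [Function.comp_apply]
  field_simp

end Limits

/-! ### The two asymptotic statements. -/

namespace OrientedGraph

theorem tendsto_inducedCopies_disjUnion (a b : ℕ → ℕ)
    (R : ∀ k : ℕ, OrientedGraph (Fin (a k))) (S : ∀ k : ℕ, OrientedGraph (Fin (b k)))
    (hR : ∀ k, (R k).IsRegularTournament) (hS : ∀ k, (S k).IsRegularTournament)
    (hab : Tendsto (fun k => a k + b k) atTop atTop)
    (hbal : Tendsto (fun k => (a k : ℝ) / ((a k : ℝ) + (b k : ℝ))) atTop (𝓝 (1 / 2))) :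
    Tendsto (fun k => (inducedCopies triangleWithIsolatedVertex ((R k).disjUnion (S k)) : ℝ) /
      ((a k + b k).choose 4 : ℝ)) atTop (𝓝 (1 / 8)) := by
  have hinv : Tendsto (fun k => (((a k + b k : ℕ) : ℝ))⁻¹) atTop (𝓝 0) :=
    tendsto_inv_atTop_zero.comp (tendsto_natCast_atTop_atTop.comp hab)
  -- With `p = a / (a + b)`, the lower bound divided by `(a + b) ^ 4` is `p * (1 - p) * (p ^ 2 + (1
  -- - p) ^ 2 - 2 / (a + b) ^ 2)`, which tends to `1/4 * 1/2`.
  have hc := (hbal.mul (hbal.const_sub 1)).mul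
    (((hbal.pow 2).add ((hbal.const_sub 1).pow 2)).sub ((hinv.pow 2).const_mul 2))
  refine tendsto_div_choose_of_squeeze hab (fun k => ?_) (by convert hc using 2; norm_num) ?_
  · simpa using inducedCopies_triangleWithIsolatedVertex_le ((R k).disjUnion (S k))
  · filter_upwards [hab.eventually_gt_atTop 0] with k hk
    have h := (hR k).le_inducedCopies_disjUnion (hS k)
    simp only [Fintype.card_fin] at h
    have h' : (a k : ℝ) * b k * ((a k : ℝ) ^ 2 + (b k : ℝ) ^ 2 - 2) ≤
        24 * inducedCopies triangleWithIsolatedVertex ((R k).disjUnion (S k)) := by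
      exact_mod_cast h
    refine le_trans (le_of_eq ?_) h'
    have hpos : (0 : ℝ) < (a k : ℝ) + b k := by exact_mod_cast hk
    push_cast
    field_simp
    ring

theorem le_maxInducedCopies (n k : ℕ) (h : 4 * k + 2 ≤ n) :
    ((2 * k + 1 : ℕ) : ℤ) ^ 2 * (2 * ((2 * k + 1 : ℕ) : ℤ) ^ 2 - 2) ≤
      24 * maxInducedCopies triangleWithIsolatedVertex n := by
  have hcard : Fintype.card (ZMod (2 * k + 1) ⊕ ZMod (2 * k + 1)) ≤ Fintype.card (Fin n) := by
    simp only [Fintype.card_sum, ZMod.card, Fintype.card_fin]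
    omega
  obtain ⟨f⟩ := Function.Embedding.nonempty_of_card_le hcard
  have h1 := (isRegularTournament_circulant k).le_inducedCopies_disjUnion
    (isRegularTournament_circulant k)
  have h2 := inducedCopies_le_extend f ((circulant k).disjUnion (circulant k))
  have h3 := (maxInducedCopies_isGreatest triangleWithIsolatedVertex n).2
    ⟨((circulant k).disjUnion (circulant k)).extend f, rfl⟩
  have h4 : (inducedCopies triangleWithIsolatedVertex ((circulant k).disjUnion (circulant k)) : ℤ) ≤
      maxInducedCopies triangleWithIsolatedVertex n := by exact_mod_cast h2.trans h3
  rw [ZMod.card] at h1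
  linarith

theorem hasInducibility_triangleWithIsolatedVertex :
    triangleWithIsolatedVertex.HasInducibility (1 / 8) := by
  have hinv : Tendsto (fun n : ℕ => ((n : ℝ))⁻¹) atTop (𝓝 0) :=
    tendsto_inv_atTop_zero.comp tendsto_natCast_atTop_atTop
  -- Regular tournaments have odd order, so two circulants of order `2 * k + 1` with `k = (n - 2) /
  -- 4` are used; for `n ≥ 2` they fit and leave at most three isolated vertices.
  have hp : Tendsto (fun n : ℕ => ((2 * ((n - 2) / 4) + 1 : ℕ) : ℝ) * (n : ℝ)⁻¹) atTop
      (𝓝 (1 / 2)) := by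
    have hlow : Tendsto (fun n : ℕ => 1 / 2 - 3 / 2 * (n : ℝ)⁻¹) atTop (𝓝 (1 / 2)) := by
      simpa only [mul_zero, sub_zero] using (hinv.const_mul (3 / 2 : ℝ)).const_sub (1 / 2)
    refine tendsto_of_tendsto_of_tendsto_of_le_of_le' hlow tendsto_const_nhds ?_ ?_
    · filter_upwards [eventually_ge_atTop 2] with n hn
      have h1 : (n : ℝ) ≤ 2 * ((2 * ((n - 2) / 4) + 1 : ℕ) : ℝ) + 3 := by
        exact_mod_cast (by omega : n ≤ 2 * (2 * ((n - 2) / 4) + 1) + 3)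
      have h2 : (0 : ℝ) < n := by positivity
      rw [← div_eq_mul_inv, ← div_eq_mul_inv, sub_le_iff_le_add, ← add_div, le_div_iff₀ h2]
      linarith
    · filter_upwards [eventually_ge_atTop 2] with n hn
      have h1 : 2 * ((2 * ((n - 2) / 4) + 1 : ℕ) : ℝ) ≤ n := by
        exact_mod_cast (by omega : 2 * (2 * ((n - 2) / 4) + 1) ≤ n)
      have h2 : (0 : ℝ) < n := by positivity
      rw [← div_eq_mul_inv, div_le_iff₀ h2]
      linarith
  have hc := (hp.pow 2).mul (((hp.pow 2).const_mul 2).sub ((hinv.pow 2).const_mul 2))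
  have hcard : Fintype.card (Fin 3 ⊕ Fin 1) = 4 := rfl
  rw [HasInducibility, hcard]
  refine tendsto_div_choose_of_squeeze tendsto_id (fun n => ?_)
    (by convert hc using 2; norm_num) ?_
  · obtain ⟨G, hG⟩ := (maxInducedCopies_isGreatest triangleWithIsolatedVertex n).1
    have := inducedCopies_triangleWithIsolatedVertex_le G
    rw [Fintype.card_fin] at this
    rw [← hG]
    exact this
  · filter_upwards [eventually_ge_atTop 2] with n hn
    have h : (((2 * ((n - 2) / 4) + 1 : ℕ) : ℝ)) ^ 2 *
        (2 * ((2 * ((n - 2) / 4) + 1 : ℕ) : ℝ) ^ 2 - 2) ≤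
        24 * maxInducedCopies triangleWithIsolatedVertex n := by
      simpa only [Int.cast_mul, Int.cast_sub, Int.cast_pow, Int.cast_natCast, Int.cast_ofNat] using
        (Int.cast_le (R := ℝ)).2 (le_maxInducedCopies n ((n - 2) / 4) (by omega))
    refine le_trans (le_of_eq ?_) h
    have h2 : (n : ℝ) ≠ 0 := by positivity
    field_simp

end OrientedGraph

theorem mainTheorem6 :
    OrientedGraph.triangleWithIsolatedVertex.HasInducibility (1 / 8) ∧
    ∀ (a b : ℕ → ℕ)
      (R : ∀ k : ℕ, OrientedGraph (Fin (a k))) (S : ∀ k : ℕ, OrientedGraph (Fin (b k))),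
      (∀ k, (R k).IsRegularTournament) → (∀ k, (S k).IsRegularTournament) →
      Tendsto (fun k => a k + b k) atTop atTop →
      Tendsto (fun k => (a k : ℝ) / ((a k : ℝ) + (b k : ℝ))) atTop (𝓝 (1 / 2)) →
      Tendsto (fun k =>
        (OrientedGraph.inducedCopies OrientedGraph.triangleWithIsolatedVertex
          ((R k).disjUnion (S k)) : ℝ) / ((a k + b k).choose 4 : ℝ))
        atTop (𝓝 (1 / 8)) :=
  ⟨OrientedGraph.hasInducibility_triangleWithIsolatedVertex,
    OrientedGraph.tendsto_inducedCopies_disjUnion⟩
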